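/- Let $M\in\mathbb N$, $\beta\ge 0$ and $\lambda,h\in\mathbb R$, and assume either $\beta\le 1$, or $\beta>1$ and $\lambda\neq 0$, $h\neq 0$. For $\boldsymbol\epsilon\in\{-1,1\}^M$ let the training set $\mathcal S=(s^\mu_i)_{\mu\le M,\,i\le N}\in\{-1,1\}^{MN}$ be distributed according to $$P^{CW}_{\beta,h\boldsymbol\epsilon}(\mathcal S)=\prod_{\mu=1}^M z_{\beta,h\epsilon^\mu}^{-1}\exp\Big(\frac\beta N\sum_{i<j}s_i^\mu s_j^\mu+h\epsilon^\mu\sum_{i=1}^N s_i^\mu\Big),$$ where $z_{\beta,h\epsilon^\mu}$ is the normalizing constant, i.e. the $M$ examples are drawn independently from Curie–Weiss measures with fields $h\epsilon^\mu$, and let $$Z(\mathcal S)=\sum_{\xi\in\{-1,1\}^N}\exp\Big(\frac\beta N\sum_{\mu=1}^M\sum_{i<j}s_i^\mu s_j^\mu\xi_i\xi_j+\lambda\sum_{i=1}^N\xi_i\Big)$$ be the partition function of the dual Hopfield model. Let $m_0=m_0(\beta,h)=\operatorname{argmax}_{x\in\mathbb R}\big[\log 2+\log\cosh(\beta x+h)-\beta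 x^2/2\big]$; for $\beta>0$ this maximizer exists, is unique and lies in $(-1,1)$, while for $\beta=0$ any $m_0\in[-1,1]$ may be taken. Then for every $\boldsymbol\epsilon\in\{-1,1\}^M$ the limit $-\beta f(\beta,M;\lambda,h\boldsymbol\epsilon)$ of the quenched free energy satisfies $$-\beta f(\beta,M;\lambda,h\boldsymbol\epsilon):=\lim_{N\to\infty}\frac1N\sum_{\mathcal S}P^{CW}_{\beta,h\boldsymbol\epsilon}(\mathcal S)\log Z(\mathcal S)=\sup_{p\in\mathbb R^M}g(p),\qquad g(p)=\log 2-\frac{\beta}{2}\sum_{\mu=1}^M p_\mu^2+\mathbb E_s\log\cosh\Big(\beta\sum_{\mu=1}^M s^\mu p_\mu+\lambda\Big),$$ where the limit exists, the supremum is finite, and $s\in\{-1,1\}^M$ has i.i.d. entries with mean $m_0$. In particular the limit does not depend on $\boldsymbol\epsilon$. -/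

import Mathlib

open Filter Topology

noncomputable section

namespace DualHopfield

/-- An Ising spin, i.e. an element of `{-1, 1}`. -/
abbrev Spin : Type := ℤˣ

/-- The value of a spin as a real number. -/
def val (s : Spin) : ℝ := ((s : ℤ) : ℝ)

/-- The Curie–Weiss exponent `(β / N) ∑_{i<j} s_i s_j + b ∑_i s_i`. -/
def cwExponent {N : ℕ} (β b : ℝ) (s : Fin N → Spin) : ℝ :=
  β / N * ∑ i, ∑ j ∈ Finset.Ioi i, val (s i) * val (s j) + b * ∑ i, val (s i)

/-- The partition function `z_{β,b}` of the Curie–Weiss model on `N` spins. -/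
def cwPartition (N : ℕ) (β b : ℝ) : ℝ :=
  ∑ s : Fin N → Spin, Real.exp (cwExponent β b s)

/-- The probability of a training set `S` of `M` independent configurations, the `μ`-th one drawn
from the Curie–Weiss measure with inverse temperature `β` and external field `b μ`. -/
def cwProb {N M : ℕ} (β : ℝ) (b : Fin M → ℝ) (S : Fin M → Fin N → Spin) : ℝ :=
  ∏ μ, Real.exp (cwExponent β (b μ) (S μ)) / cwPartition N β (b μ)

/-- The partition function of the dual Hopfield model (the posterior), with patterns `S`:
`∑_ξ exp ((β / N) ∑_μ ∑_{i<j} s_i^μ s_j^μ ξ_i ξ_j + lam ∑_i ξ_i)`. -/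
def hopfieldPartition {N M : ℕ} (β lam : ℝ) (S : Fin M → Fin N → Spin) : ℝ :=
  ∑ ξ : Fin N → Spin, Real.exp
    (β / N * ∑ μ, ∑ i, ∑ j ∈ Finset.Ioi i,
        val (S μ i) * val (S μ j) * val (ξ i) * val (ξ j)
      + lam * ∑ i, val (ξ i))

/-- The quenched quantity `-β f_N = (1 / N) ⟨log Z⟩`, the average being over the Curie–Weiss
distribution of the training set with fields `b`. -/
def quenchedPressure (N M : ℕ) (β lam : ℝ) (b : Fin M → ℝ) : ℝ :=
  1 / N * ∑ S : Fin M → Fin N → Spin, cwProb β b S * Real.log (hopfieldPartition β lam S)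

/-- The Curie–Weiss trial function, whose maximizer is the magnetization `m₀(β, h)`. -/
def cwTrial (β h x : ℝ) : ℝ :=
  Real.log 2 + Real.log (Real.cosh (β * x + h)) - β * x ^ 2 / 2

/-- Expectation of `F s`, where the entries of `s ∈ {-1, 1}^M` are i.i.d. with mean `m`: an entry
takes the value `σ = ±1` with probability `(1 + m σ) / 2`. -/
def spinExpect {M : ℕ} (m : ℝ) (F : (Fin M → Spin) → ℝ) : ℝ :=
  ∑ s : Fin M → Spin, (∏ μ, (1 + m * val (s μ)) / 2) * F s

/-- The trial function
`g(p) = log 2 - β p² / 2 + E log cosh (β s·p + lam)`, for `s` with i.i.d. entries of mean `m`. -/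
def trial {M : ℕ} (β lam m : ℝ) (p : Fin M → ℝ) : ℝ :=
  Real.log 2 - β * (∑ μ, p μ ^ 2) / 2 +
    spinExpect m fun s => Real.log (Real.cosh (β * ∑ μ, val (s μ) * p μ + lam))

end DualHopfield

end

/-! Up to a bounded factor, `Z` is the sum over `ξ` of `weight`, i.e. of `exp (N β |m|² / 2 + lam ∑
ξ_i)` with `m` the overlap vector. Since `|m|² / 2 ≥ p·m - |p|² / 2`, with equality at `p = m`,
replacing the square by its linearization at `p` bounds the sum from below, and the linearized sum
factorizes over sites (`exp_linearized_le_sum_weight`). Conversely `m` takes at most `(2N+1)^M`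
values, and on each fibre the linearization at that value is exact (`sum_weight_filter_le`). Hence
`N⁻¹ log Z` is the maximum of `linearized` over `p`, up to `O(log N / N)`.

`linearized` sees the training set only through the empirical law of its columns in `{-1, 1}^M`.
That law converges in mean to the i.i.d. law of mean `m₀` (`tendsto_meanDistance`): the same
linearization, with one constant pattern, concentrates the Curie–Weiss magnetization at `m₀`, and
exchangeability turns its two moments into one- and two-site correlations. A fixed `p` then gives
the lower bound; total variation control, uniform over the cube `|p μ| ≤ 1`, gives the upper one.
Flipping patterns removes the signs `ε`. -/

namespace DualHopfield

/-! ### Calculus of `tanh` and `log cosh` -/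

lemma hasDerivAt_log_cosh (x : ℝ) :
    HasDerivAt (fun y => Real.log (Real.cosh y)) (Real.tanh x) x := by
  rw [Real.tanh_eq_sinh_div_cosh]
  exact (Real.hasDerivAt_cosh x).log (Real.cosh_pos x).ne'

lemma hasDerivAt_tanh (x : ℝ) : HasDerivAt Real.tanh (1 - Real.tanh x ^ 2) x := by
  have hc := (Real.cosh_pos x).ne'
  have h := (Real.hasDerivAt_sinh x).div (Real.hasDerivAt_cosh x) hc
  have e : Real.tanh = Real.sinh / Real.cosh := by
    funext y
    simp [Real.tanh_eq_sinh_div_cosh]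
  rw [e]
  refine h.congr_deriv ?_
  rw [Pi.div_apply]
  field_simp

lemma tanh_strictMono : StrictMono Real.tanh := by
  refine strictMono_of_hasDerivAt_pos hasDerivAt_tanh fun x => ?_
  linarith [Real.tanh_sq_lt_one x]

/-- The derivative of `z - tanh z` is `tanh² z`, which vanishes only at `0`, so this monotone
function is constant on no interval. -/
lemma tanh_sub_lt {x y : ℝ} (hxy : x < y) : Real.tanh y - Real.tanh x < y - x := by
  have hmono : Monotone fun z => z - Real.tanh z :=
    monotone_of_hasDerivAt_nonneg (fun z => (hasDerivAt_id z).sub (hasDerivAt_tanh z))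
      fun z => by simpa using sq_nonneg (Real.tanh z)
  have hle : ∀ a b, a ≤ b → a - Real.tanh a ≤ b - Real.tanh b := fun a b h => hmono h
  by_contra! hcon
  have hconst : ∀ z ∈ Set.Icc x y, z - Real.tanh z = x - Real.tanh x := fun z hz =>
    le_antisymm (by linarith [hle z y hz.2]) (hle x z hz.1)
  obtain ⟨z, hz, hz0⟩ : ∃ z ∈ Set.Ioo x y, z ≠ 0 := by
    by_cases h0 : (x + y) / 2 = 0
    · exact ⟨(x + 3 * y) / 4, ⟨by linarith, by linarith⟩, by
        intro h; linarith⟩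
    · exact ⟨(x + y) / 2, ⟨by linarith, by linarith⟩, h0⟩
  have hd : HasDerivAt (fun z => z - Real.tanh z) (1 - (1 - Real.tanh z ^ 2)) z :=
    (hasDerivAt_id z).sub (hasDerivAt_tanh z)
  have hc : HasDerivAt (fun z => z - Real.tanh z) 0 z := by
    refine (hasDerivAt_const z (x - Real.tanh x)).congr_of_eventuallyEq ?_
    filter_upwards [Ioo_mem_nhds hz.1 hz.2] with w hw
    exact hconst w ⟨hw.1.le, hw.2.le⟩
  have h0 := hd.unique hc
  have ht : Real.tanh z = 0 := by
    have : Real.tanh z ^ 2 = 0 := by linarith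
    simpa using this
  exact hz0 (tanh_strictMono.injective (by rw [ht, Real.tanh_zero]))

lemma tanh_concaveOn : ConcaveOn ℝ (Set.Ici (0 : ℝ)) Real.tanh := by
  refine AntitoneOn.concaveOn_of_deriv (convex_Ici 0)
    (fun x _ => (hasDerivAt_tanh x).continuousAt.continuousWithinAt)
    (fun x _ => (hasDerivAt_tanh x).differentiableAt.differentiableWithinAt) ?_
  intro x hx y _ hxy
  rw [interior_Ici] at hx
  rw [(hasDerivAt_tanh x).deriv, (hasDerivAt_tanh y).deriv]
  have h0 : 0 ≤ Real.tanh x := by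
    rw [← Real.tanh_zero]
    exact tanh_strictMono.monotone (le_of_lt hx)
  have h1 := tanh_strictMono.monotone hxy
  nlinarith

lemma log_cosh_nonneg (x : ℝ) : 0 ≤ Real.log (Real.cosh x) :=
  Real.log_nonneg (Real.one_le_cosh x)

lemma log_cosh_le_abs (x : ℝ) : Real.log (Real.cosh x) ≤ |x| := by
  rw [Real.log_le_iff_le_exp (Real.cosh_pos x), Real.cosh_eq]
  have h1 : Real.exp x ≤ Real.exp |x| := Real.exp_le_exp.2 (le_abs_self x)
  have h2 : Real.exp (-x) ≤ Real.exp |x| := Real.exp_le_exp.2 (neg_le_abs x)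
  linarith

/-! ### Existence and uniqueness of the Curie–Weiss maximizer -/

lemma cwTrial_hasDerivAt (β h x : ℝ) :
    HasDerivAt (cwTrial β h) (β * (Real.tanh (β * x + h) - x)) x := by
  have h1 : HasDerivAt (fun y : ℝ => β * y + h) β x := by
    simpa using ((hasDerivAt_id x).const_mul β).add_const h
  have h2 := (hasDerivAt_log_cosh (β * x + h)).comp x h1
  have h3 : HasDerivAt (fun y : ℝ => β * y ^ 2 / 2) (β * x) x := by
    refine (((hasDerivAt_pow 2 x).const_mul β).div_const 2).congr_deriv ?_
    norm_num
    ring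
  refine ((h2.const_add (Real.log 2)).sub h3).congr_deriv ?_
  ring

lemma cwTrial_continuous (β h : ℝ) : Continuous (cwTrial β h) :=
  continuous_iff_continuousAt.2 fun x => (cwTrial_hasDerivAt β h x).continuousAt

lemma cwTrial_neg (β h x : ℝ) : cwTrial β (-h) (-x) = cwTrial β h x := by
  unfold cwTrial
  rw [show β * -x + -h = -(β * x + h) by ring, Real.cosh_neg, neg_sq]

lemma exists_isMaxOn_cwTrial {β : ℝ} (hβ : 0 < β) (h : ℝ) :
    ∃ x, IsMaxOn (cwTrial β h) Set.univ x := by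
  have hb : ∀ x, cwTrial β h x ≤ (Real.log 2 + |h|) + β * (|x| - x ^ 2 / 2) := fun x => by
    have h1 := log_cosh_le_abs (β * x + h)
    have h2 : |β * x + h| ≤ β * |x| + |h| := by
      simpa [abs_mul, abs_of_pos hβ] using abs_add_le (β * x) h
    unfold cwTrial
    linarith
  -- Beyond this radius the quadratic term beats `β |y| + |h|`, so the trial function falls below
  -- `log 2`, hence below its value at `0`.
  set R : ℝ := 2 + 2 * |h| / β with hR
  have hR2 : 2 ≤ R := by
    have : 0 ≤ 2 * |h| / β := by positivity
    linarith
  obtain ⟨x, -, hx⟩ := (isCompact_Icc (a := -R) (b := R)).exists_isMaxOn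
    ⟨0, by constructor <;> linarith⟩ (cwTrial_continuous β h).continuousOn
  refine ⟨x, fun y _ => ?_⟩
  show cwTrial β h y ≤ cwTrial β h x
  by_cases hy : y ∈ Set.Icc (-R) R
  · exact hx hy
  · have hyR : R < |y| := by
      by_contra! hc
      exact hy ⟨(abs_le.1 hc).1, (abs_le.1 hc).2⟩
    have h0 : cwTrial β h 0 ≤ cwTrial β h x := hx ⟨by linarith, by linarith⟩
    have h1 : Real.log 2 ≤ cwTrial β h 0 := by
      have := log_cosh_nonneg (β * 0 + h)
      unfold cwTrial
      linarith
    have h2 := hb y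
    have h3 : β * (|y| - y ^ 2 / 2) ≤ -|h| := by
      have e : y ^ 2 = |y| ^ 2 := (sq_abs y).symm
      have h4 : |y| - y ^ 2 / 2 ≤ -(|h| / β) := by
        have : 2 * |h| / β = 2 * (|h| / β) := by ring
        rw [e]
        nlinarith [show 0 ≤ |h| / β by positivity]
      calc β * (|y| - y ^ 2 / 2) ≤ β * -(|h| / β) := mul_le_mul_of_nonneg_left h4 hβ.le
        _ = -|h| := by field_simp
    linarith

lemma tanh_eq_of_isMaxOn_cwTrial {β h x : ℝ} (hβ : 0 < β)
    (hx : IsMaxOn (cwTrial β h) Set.univ x) : Real.tanh (β * x + h) = x := by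
  have hl : IsLocalMax (cwTrial β h) x := hx.isLocalMax Filter.univ_mem
  have := hl.hasDerivAt_eq_zero (cwTrial_hasDerivAt β h x)
  have h2 := (mul_eq_zero.1 this).resolve_left hβ.ne'
  linarith

/-- Reflecting a negative `x` keeps the quadratic term and strictly increases `|β x + h|`. -/
lemma nonneg_of_isMaxOn_cwTrial {β h x : ℝ} (hβ : 0 < β) (hh : 0 < h)
    (hx : IsMaxOn (cwTrial β h) Set.univ x) : 0 ≤ x := by
  by_contra! hneg
  have h1 : cwTrial β h (-x) ≤ cwTrial β h x := hx (Set.mem_univ (-x))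
  have hp : 0 < β * -x := mul_pos hβ (by linarith)
  have h2 : Real.cosh (β * x + h) < Real.cosh (β * -x + h) := by
    rw [Real.cosh_lt_cosh, abs_of_pos (by linarith : 0 < β * -x + h)]
    rw [abs_lt]
    constructor <;> linarith
  have h3 := Real.log_lt_log (Real.cosh_pos _) h2
  unfold cwTrial at h1
  rw [neg_sq] at h1
  linarith

/-- The point `β x + h` divides the segment from `h` to `β y + h` with weight `x / y`. Concavity of
`tanh` there gives `x ≥ (1 - x / y) tanh h + x`, impossible since `tanh h > 0`. -/
lemma tanh_fixedPoint_unique_of_pos {β h x y : ℝ} (hβ : 0 < β) (hh : 0 < h) (hx0 : 0 ≤ x)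
    (hx : Real.tanh (β * x + h) = x) (hy : Real.tanh (β * y + h) = y) (hxy : x < y) : False := by
  have hpos : 0 < Real.tanh h := by
    rw [← Real.tanh_zero]
    exact tanh_strictMono hh
  have hx1 : 0 < x := by
    rw [← hx]
    refine hpos.trans_le (tanh_strictMono.monotone ?_)
    nlinarith
  have hy1 : 0 < y := hx1.trans hxy
  have ht : 0 < 1 - x / y := by
    rw [sub_pos, div_lt_one hy1]
    exact hxy
  have hc := tanh_concaveOn.2 (Set.mem_Ici.2 hh.le)
    (Set.mem_Ici.2 (by positivity : 0 ≤ β * y + h)) ht.le (by positivity : 0 ≤ x / y) (by ring)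
  have e : (1 - x / y) • h + (x / y) • (β * y + h) = β * x + h := by
    simp only [smul_eq_mul]
    field_simp
    ring
  rw [e, hx, hy] at hc
  simp only [smul_eq_mul] at hc
  rw [div_mul_cancel₀ _ hy1.ne'] at hc
  nlinarith [mul_pos ht hpos]

/-- For `β ≤ 1` the map `x ↦ tanh (β x + h)` strictly shrinks distances, so it has one fixed point.
For `h ≠ 0` several fixed points may exist, but after reflecting to `h > 0` maximizers are
nonnegative, where the fixed point is unique. -/
lemma isMaxOn_cwTrial_unique {β h x y : ℝ} (hβ : 0 < β) (hreg : β ≤ 1 ∨ h ≠ 0)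
    (hx : IsMaxOn (cwTrial β h) Set.univ x) (hy : IsMaxOn (cwTrial β h) Set.univ y) : x = y := by
  rcases hreg with hb | hh
  · have key : ∀ {x y : ℝ}, Real.tanh (β * x + h) = x → Real.tanh (β * y + h) = y →
        ¬ x < y := by
      intro x y hx hy hxy
      have := tanh_sub_lt (x := β * x + h) (y := β * y + h) (by nlinarith)
      rw [hx, hy] at this
      nlinarith
    have ex := tanh_eq_of_isMaxOn_cwTrial hβ hx
    have ey := tanh_eq_of_isMaxOn_cwTrial hβ hy
    exact le_antisymm (not_lt.1 (key ey ex)) (not_lt.1 (key ex ey))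
  · have key : ∀ {h x y : ℝ}, 0 < h → IsMaxOn (cwTrial β h) Set.univ x →
        IsMaxOn (cwTrial β h) Set.univ y → ¬ x < y := fun hh hx hy hxy =>
      tanh_fixedPoint_unique_of_pos hβ hh (nonneg_of_isMaxOn_cwTrial hβ hh hx)
        (tanh_eq_of_isMaxOn_cwTrial hβ hx) (tanh_eq_of_isMaxOn_cwTrial hβ hy) hxy
    rcases lt_or_gt_of_ne hh with hn | hp
    · have flip : ∀ {z}, IsMaxOn (cwTrial β h) Set.univ z →
          IsMaxOn (cwTrial β (-h)) Set.univ (-z) := by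
        intro z hz w _
        have : cwTrial β h (-w) ≤ cwTrial β h z := hz (Set.mem_univ _)
        rw [← cwTrial_neg β h z, ← cwTrial_neg β h (-w), neg_neg] at this
        exact this
      have hn' : 0 < -h := by linarith
      have h1 := not_lt.1 (key hn' (flip hx) (flip hy))
      have h2 := not_lt.1 (key hn' (flip hy) (flip hx))
      linarith
    · exact le_antisymm (not_lt.1 (key hp hy hx)) (not_lt.1 (key hp hx hy))

lemma exists_unique_isMaxOn_cwTrial {β h : ℝ} (hβ : 0 < β) (hreg : β ≤ 1 ∨ h ≠ 0) :
    ∃ m ∈ Set.Ioo (-1 : ℝ) 1, IsMaxOn (cwTrial β h) Set.univ m ∧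
      ∀ y, IsMaxOn (cwTrial β h) Set.univ y → y = m := by
  obtain ⟨m, hm⟩ := exists_isMaxOn_cwTrial hβ h
  have e := tanh_eq_of_isMaxOn_cwTrial hβ hm
  refine ⟨m, ?_, hm, fun y hy => isMaxOn_cwTrial_unique hβ hreg hy hm⟩
  rw [← e]
  exact ⟨Real.neg_one_lt_tanh _, Real.tanh_lt_one _⟩

/-! ### Spins and sums over configurations -/

lemma val_one : val 1 = 1 := by simp [val]

lemma val_neg_one : val (-1) = -1 := by simp [val]

lemma val_sq (s : Spin) : val s ^ 2 = 1 := by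
  rcases Int.units_eq_one_or s with rfl | rfl <;> simp [val]

lemma val_mul (s t : Spin) : val (s * t) = val s * val t := by simp [val]

lemma abs_val (s : Spin) : |val s| = 1 := by
  rcases Int.units_eq_one_or s with rfl | rfl <;> simp [val]

lemma sum_spin (f : Spin → ℝ) : ∑ s, f s = f 1 + f (-1) := by
  rw [UnitsInt.univ, Finset.sum_pair (by decide)]

lemma sum_prod_pi {ι κ : Type*} [Fintype ι] [DecidableEq ι] [Fintype κ] (f : ι → κ → ℝ) :
    ∑ x : ι → κ, ∏ i, f i (x i) = ∏ i, ∑ k, f i k := by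
  rw [Finset.prod_univ_sum, Fintype.piFinset_univ]

lemma sum_Ioi_mul {N : ℕ} (x : Fin N → ℝ) :
    ∑ i, ∑ j ∈ Finset.Ioi i, x i * x j = ((∑ i, x i) ^ 2 - ∑ i, x i ^ 2) / 2 := by
  have h := Finset.sum_sum_Ioi_add_eq_sum_sum_off_diag fun i j : Fin N => x i * x j
  have h1 : ∑ i, ∑ j ∈ Finset.Ioi i, (x j * x i + x i * x j) =
      2 * ∑ i, ∑ j ∈ Finset.Ioi i, x i * x j := by
    simp only [Finset.mul_sum]
    exact Finset.sum_congr rfl fun i _ => Finset.sum_congr rfl fun j _ => by ring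
  have h2 : ∑ i, ∑ j ∈ ({i}ᶜ : Finset (Fin N)), x j * x i = (∑ i, x i) ^ 2 - ∑ i, x i ^ 2 := by
    rw [sq, Finset.sum_mul_sum, ← Finset.sum_sub_distrib]
    refine Finset.sum_congr rfl fun i _ => ?_
    have := Finset.sum_compl_add_sum ({i} : Finset (Fin N)) fun j => x i * x j
    rw [Finset.sum_singleton] at this
    rw [← this, Finset.sum_congr rfl fun j _ => mul_comm (x j) (x i)]
    ring
  rw [h1, h2] at h
  linarith

lemma sum_Ioi_spin {N : ℕ} (x : Fin N → ℝ) (hx : ∀ i, x i ^ 2 = 1) :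
    ∑ i, ∑ j ∈ Finset.Ioi i, x i * x j = ((∑ i, x i) ^ 2 - N) / 2 := by
  rw [sum_Ioi_mul]
  simp [hx]

/-! ### Linearization of the quadratic energy -/

/-- The overlaps of a configuration `ξ` with the patterns `a`. -/
noncomputable def overlap {N M : ℕ} (a : Fin M → Fin N → Spin) (ξ : Fin N → Spin) (μ : Fin M) : ℝ :=
  (∑ i, val (a μ i) * val (ξ i)) / N

/-- The Boltzmann weight `exp (N (β |m|² / 2 + lam * magnetization))` in terms of the overlaps `m`
of `ξ` with the patterns `a`. -/
noncomputable def weight {N M : ℕ} (β lam : ℝ) (a : Fin M → Fin N → Spin) (ξ : Fin N → Spin) : ℝ :=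
  Real.exp (N * (β / 2 * ∑ μ, overlap a ξ μ ^ 2) + lam * ∑ i, val (ξ i))

/-- The linearized free energy `-β |p|² / 2 + N⁻¹ ∑_i log (2 cosh (β a_i·p + lam))`. -/
noncomputable def linearized {N M : ℕ} (β lam : ℝ) (a : Fin M → Fin N → Spin) (p : Fin M → ℝ) : ℝ :=
  (∑ i, Real.log (2 * Real.cosh (β * ∑ μ, val (a μ i) * p μ + lam))) / N
    - β / 2 * ∑ μ, p μ ^ 2

lemma overlap_mem {N M : ℕ} (a : Fin M → Fin N → Spin) (ξ : Fin N → Spin) (μ : Fin M) :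
    |overlap a ξ μ| ≤ 1 := by
  unfold overlap
  rw [abs_div, Nat.abs_cast]
  refine div_le_one_of_le₀ ?_ (Nat.cast_nonneg N)
  refine (Finset.abs_sum_le_sum_abs _ _).trans ?_
  simp [abs_mul, abs_val]

lemma sum_exp_linear {N : ℕ} (c : Fin N → ℝ) :
    ∑ ξ : Fin N → Spin, Real.exp (∑ i, c i * val (ξ i)) = ∏ i, (2 * Real.cosh (c i)) := by
  simp only [Real.exp_sum]
  rw [sum_prod_pi fun i (s : Spin) => Real.exp (c i * val s)]
  refine Finset.prod_congr rfl fun i _ => ?_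
  rw [sum_spin, val_one, val_neg_one, Real.cosh_eq]
  ring_nf

lemma sum_exp_linearized {N M : ℕ} (hN : 0 < N) (β lam : ℝ) (a : Fin M → Fin N → Spin)
    (p : Fin M → ℝ) :
    ∑ ξ : Fin N → Spin, Real.exp (N * (β * (∑ μ, p μ * overlap a ξ μ) - β / 2 * ∑ μ, p μ ^ 2)
      + lam * ∑ i, val (ξ i)) = Real.exp (N * linearized β lam a p) := by
  have hN' : (N : ℝ) ≠ 0 := by positivity
  have e : ∀ ξ : Fin N → Spin,
      N * (β * (∑ μ, p μ * overlap a ξ μ) - β / 2 * ∑ μ, p μ ^ 2) + lam * ∑ i, val (ξ i) =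
      -(N * (β / 2 * ∑ μ, p μ ^ 2)) +
        ∑ i, (β * ∑ μ, val (a μ i) * p μ + lam) * val (ξ i) := fun ξ => by
    have h1 : (N : ℝ) * (β * ∑ μ, p μ * overlap a ξ μ) =
        ∑ i, (β * ∑ μ, val (a μ i) * p μ) * val (ξ i) := by
      simp only [overlap, Finset.mul_sum, Finset.sum_mul, Finset.sum_div]
      rw [Finset.sum_comm]
      refine Finset.sum_congr rfl fun i _ => Finset.sum_congr rfl fun μ _ => ?_
      field_simp
    simp only [add_mul, Finset.sum_add_distrib, ← Finset.mul_sum]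
    rw [← h1]
    ring
  simp only [e, Real.exp_add, ← Finset.mul_sum]
  rw [sum_exp_linear, linearized, mul_sub, Real.exp_sub, Real.exp_neg, mul_div_cancel₀ _ hN',
    Real.exp_sum]
  rw [Finset.prod_congr rfl fun i _ => Real.exp_log (by positivity)]
  exact (div_eq_inv_mul _ _).symm

lemma exp_linearized_le_sum_weight {N M : ℕ} (hN : 0 < N) {β : ℝ} (hβ : 0 ≤ β) (lam : ℝ)
    (a : Fin M → Fin N → Spin) (p : Fin M → ℝ) :
    Real.exp (N * linearized β lam a p) ≤ ∑ ξ, weight β lam a ξ := by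
  rw [← sum_exp_linearized hN]
  refine Finset.sum_le_sum fun ξ _ => ?_
  unfold weight
  gcongr
  have h : ∑ μ, p μ * overlap a ξ μ ≤ (∑ μ, p μ ^ 2 + ∑ μ, overlap a ξ μ ^ 2) / 2 := by
    rw [← Finset.sum_add_distrib, Finset.sum_div]
    exact Finset.sum_le_sum fun μ _ => by nlinarith [sq_nonneg (p μ - overlap a ξ μ)]
  nlinarith [mul_le_mul_of_nonneg_left h hβ]

lemma sum_val_mem {N : ℕ} (ξ : Fin N → Spin) :
    ∑ i, (ξ i : ℤ) ∈ Finset.Icc (-N : ℤ) N := by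
  have : |∑ i, (ξ i : ℤ)| ≤ N := by
    refine (Finset.abs_sum_le_sum_abs _ _).trans (le_of_eq ?_)
    simp [Int.abs_eq_natAbs]
  rw [Finset.mem_Icc]
  exact abs_le.1 this

/-- The finite set of possible overlap vectors. -/
noncomputable def overlapGrid (N M : ℕ) : Finset (Fin M → ℝ) :=
  (Fintype.piFinset fun _ : Fin M => Finset.Icc (-N : ℤ) N).image fun k μ => (k μ : ℝ) / N

lemma card_overlapGrid_le (N M : ℕ) : (overlapGrid N M).card ≤ (2 * N + 1) ^ M := by
  refine Finset.card_image_le.trans ?_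
  rw [Fintype.card_piFinset]
  simp only [Int.card_Icc, Finset.prod_const, Finset.card_univ, Fintype.card_fin]
  exact Nat.pow_le_pow_left (by omega) _

lemma overlap_mem_grid {N M : ℕ} (a : Fin M → Fin N → Spin) (ξ : Fin N → Spin) :
    overlap a ξ ∈ overlapGrid N M := by
  refine Finset.mem_image.2 ⟨fun μ => ∑ i, ((a μ i * ξ i : Spin) : ℤ), ?_, ?_⟩
  · exact Fintype.mem_piFinset.2 fun μ => sum_val_mem fun i => a μ i * ξ i
  · funext μ
    simp [overlap, val]

/-- On the fibre `overlap a ξ = p` the weight equals its linearization at `p`; extending that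
linearized sum to all `ξ` costs nothing and makes it explicit. The predicate `K` serves the large
deviation bound for the magnetization; the free energy takes it trivial. -/
lemma sum_weight_filter_le {N M : ℕ} (hN : 0 < N) (β lam : ℝ)
    (a : Fin M → Fin N → Spin) (K : (Fin M → ℝ) → Prop) [DecidablePred K] (B : ℝ)
    (hB : ∀ p : Fin M → ℝ, (∀ μ, |p μ| ≤ 1) → K p → linearized β lam a p ≤ B) :
    ∑ ξ with K (overlap a ξ), weight β lam a ξ ≤ (2 * N + 1) ^ M * Real.exp (N * B) := by
  set A := (Finset.univ.filter fun ξ => K (overlap a ξ)).image (overlap a) with hA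
  have hcard : (A.card : ℝ) ≤ (2 * N + 1) ^ M := by
    have h1 : A.card ≤ (2 * N + 1) ^ M := by
      refine le_trans (Finset.card_le_card ?_) (card_overlapGrid_le N M)
      intro p hp
      obtain ⟨ξ, -, rfl⟩ := Finset.mem_image.1 hp
      exact overlap_mem_grid a ξ
    exact_mod_cast h1
  calc ∑ ξ with K (overlap a ξ), weight β lam a ξ
      = ∑ p ∈ A, ∑ ξ ∈ (Finset.univ.filter fun ξ => K (overlap a ξ)) with overlap a ξ = p,
          weight β lam a ξ :=
        (Finset.sum_fiberwise_of_maps_to (fun ξ hξ => Finset.mem_image_of_mem _ hξ) _).symm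
    _ ≤ ∑ p ∈ A, Real.exp (N * B) := by
        refine Finset.sum_le_sum fun p hp => ?_
        have hp' : linearized β lam a p ≤ B := by
          obtain ⟨ξ, hξ, rfl⟩ := Finset.mem_image.1 hp
          exact hB _ (overlap_mem a ξ) (Finset.mem_filter.1 hξ).2
        refine le_trans ?_ (Real.exp_le_exp.2 (mul_le_mul_of_nonneg_left hp' (Nat.cast_nonneg N)))
        rw [← sum_exp_linearized hN]
        refine le_trans (Finset.sum_le_sum fun ξ hξ => ?_)
          (Finset.sum_le_sum_of_subset_of_nonneg (Finset.subset_univ _)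
            fun ξ _ _ => (Real.exp_pos _).le)
        have e : overlap a ξ = p := (Finset.mem_filter.1 hξ).2
        unfold weight
        rw [← e]
        refine le_of_eq (congrArg Real.exp ?_)
        simp only [← sq]
        ring
    _ = A.card * Real.exp (N * B) := by simp
    _ ≤ _ := by gcongr

lemma sum_weight_le {N M : ℕ} (hN : 0 < N) (β lam : ℝ)
    (a : Fin M → Fin N → Spin) (B : ℝ)
    (hB : ∀ p : Fin M → ℝ, (∀ μ, |p μ| ≤ 1) → linearized β lam a p ≤ B) :
    ∑ ξ, weight β lam a ξ ≤ (2 * N + 1) ^ M * Real.exp (N * B) := by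
  simpa using sum_weight_filter_le hN β lam a (fun _ => True) B fun p hp _ => hB p hp

/-- The prefactor removes the diagonal `i = j` of each squared overlap, which contributes `β / 2`
per pattern. -/
lemma hopfieldPartition_eq {N M : ℕ} (hN : 0 < N) (β lam : ℝ) (S : Fin M → Fin N → Spin) :
    hopfieldPartition β lam S = Real.exp (-(β * M / 2)) * ∑ ξ, weight β lam S ξ := by
  have hN' : (N : ℝ) ≠ 0 := by positivity
  unfold hopfieldPartition weight
  rw [Finset.mul_sum]
  refine Finset.sum_congr rfl fun ξ _ => ?_
  rw [← Real.exp_add]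
  congr 1
  have h1 : ∀ μ, ∑ i, ∑ j ∈ Finset.Ioi i, val (S μ i) * val (S μ j) * val (ξ i) * val (ξ j) =
      ((∑ i, val (S μ i) * val (ξ i)) ^ 2 - N) / 2 := fun μ => by
    rw [← sum_Ioi_spin (fun i => val (S μ i) * val (ξ i)) fun i => by
      rw [mul_pow, val_sq, val_sq, one_mul]]
    exact Finset.sum_congr rfl fun i _ => Finset.sum_congr rfl fun j _ => by ring
  simp only [h1, overlap, div_pow, ← Finset.sum_div, Finset.sum_sub_distrib, Finset.sum_const,
    Finset.card_univ, Fintype.card_fin, nsmul_eq_mul]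
  field_simp
  ring

lemma exp_cwExponent {N : ℕ} (hN : 0 < N) (β h : ℝ) (s : Fin N → Spin) :
    Real.exp (cwExponent β h s) =
      Real.exp (-(β / 2)) * weight β h (fun (_ : Fin 1) (_ : Fin N) => 1) s := by
  have hN' : (N : ℝ) ≠ 0 := by positivity
  unfold cwExponent weight
  rw [← Real.exp_add, sum_Ioi_spin _ fun i => val_sq (s i)]
  congr 1
  simp only [overlap, val_one, one_mul, Finset.univ_unique, Finset.sum_singleton, div_pow]
  field_simp
  ring

/-! ### Concentration of the Curie–Weiss magnetization -/

lemma sq_sum_mul_le {ι : Type*} [Fintype ι] {w f : ι → ℝ} (hw : ∀ i, 0 ≤ w i)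
    (h1 : ∑ i, w i = 1) : (∑ i, w i * f i) ^ 2 ≤ ∑ i, w i * f i ^ 2 := by
  set a := ∑ i, w i * f i with ha
  have h0 : 0 ≤ ∑ i, w i * (f i - a) ^ 2 :=
    Finset.sum_nonneg fun i _ => mul_nonneg (hw i) (sq_nonneg _)
  have e : ∑ i, w i * (f i - a) ^ 2 = ∑ i, w i * f i ^ 2 - 2 * a * a + a ^ 2 := by
    calc ∑ i, w i * (f i - a) ^ 2
        = ∑ i, (w i * f i ^ 2 - 2 * a * (w i * f i) + a ^ 2 * w i) :=
          Finset.sum_congr rfl fun i _ => by ring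
      _ = _ := by
          rw [Finset.sum_add_distrib, Finset.sum_sub_distrib, ← Finset.mul_sum, ← Finset.mul_sum,
            h1, ← ha, mul_one]
  rw [e] at h0
  linarith

/-- The Curie–Weiss probability of a single configuration. -/
noncomputable def gibbs {N : ℕ} (β h : ℝ) (s : Fin N → Spin) : ℝ :=
  Real.exp (cwExponent β h s) / cwPartition N β h

/-- The magnetization of a configuration. -/
noncomputable def mag {N : ℕ} (s : Fin N → Spin) : ℝ := (∑ i, val (s i)) / N

/-- The mean magnetization of the Curie–Weiss model. -/
noncomputable def meanMag (N : ℕ) (β h : ℝ) : ℝ :=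
  ∑ s : Fin N → Spin, gibbs β h s * mag s

/-- The second moment of the magnetization of the Curie–Weiss model. -/
noncomputable def meanSqMag (N : ℕ) (β h : ℝ) : ℝ :=
  ∑ s : Fin N → Spin, gibbs β h s * mag s ^ 2

lemma cwPartition_pos (N : ℕ) (β h : ℝ) : 0 < cwPartition N β h :=
  Finset.sum_pos (fun _ _ => Real.exp_pos _) Finset.univ_nonempty

lemma gibbs_nonneg {N : ℕ} (β h : ℝ) (s : Fin N → Spin) : 0 ≤ gibbs β h s :=
  div_nonneg (Real.exp_pos _).le (cwPartition_pos N β h).le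

lemma sum_gibbs (N : ℕ) (β h : ℝ) : ∑ s : Fin N → Spin, gibbs β h s = 1 := by
  unfold gibbs
  rw [← Finset.sum_div]
  exact div_self (cwPartition_pos N β h).ne'

lemma abs_mag_le {N : ℕ} (s : Fin N → Spin) : |mag s| ≤ 1 := by
  have := overlap_mem (fun (_ : Fin 1) (_ : Fin N) => 1) s 0
  simpa [overlap, val_one, mag] using this

lemma gibbs_eq_weight {N : ℕ} (hN : 0 < N) (β h : ℝ) (s : Fin N → Spin) :
    gibbs β h s = weight β h (fun (_ : Fin 1) (_ : Fin N) => 1) s /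
      ∑ t, weight β h (fun (_ : Fin 1) (_ : Fin N) => 1) t := by
  unfold gibbs cwPartition
  simp only [exp_cwExponent hN, ← Finset.mul_sum]
  rw [mul_div_mul_left _ _ (Real.exp_pos _).ne']

lemma linearized_one {N : ℕ} (hN : 0 < N) (β h : ℝ) (p : Fin 1 → ℝ) :
    linearized β h (fun (_ : Fin 1) (_ : Fin N) => 1) p = cwTrial β h (p 0) := by
  have hN' : (N : ℝ) ≠ 0 := by positivity
  unfold linearized cwTrial
  simp only [val_one, one_mul, Finset.univ_unique, Finset.sum_singleton, Finset.sum_const,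
    Finset.card_univ, Fintype.card_fin, nsmul_eq_mul, Fin.default_eq_zero]
  rw [mul_div_cancel_left₀ _ hN', Real.log_mul two_ne_zero (Real.cosh_pos _).ne']
  ring

/-- By compactness the maximum away from `m` is attained, and a tie with the value at `m` would give
a second maximizer. -/
lemma exists_lt_cwTrial {β h m : ℝ} (hm : IsMaxOn (cwTrial β h) Set.univ m)
    (huniq : ∀ y, IsMaxOn (cwTrial β h) Set.univ y → y = m) {δ : ℝ} (hδ : 0 < δ) :
    ∃ B < cwTrial β h m, ∀ x, |x| ≤ 1 → δ ≤ |x - m| → cwTrial β h x ≤ B := by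
  set K : Set ℝ := {x | |x| ≤ 1} ∩ {x | δ ≤ |x - m|} with hK
  have hKc : IsCompact K := by
    have : {x : ℝ | |x| ≤ 1} = Set.Icc (-1) 1 := by
      ext x
      simp [abs_le]
    rw [hK, this]
    exact isCompact_Icc.inter_right (isClosed_le continuous_const (by fun_prop))
  rcases K.eq_empty_or_nonempty with h0 | h0
  · refine ⟨cwTrial β h m - 1, by linarith, fun x hx hx' => ?_⟩
    have : x ∈ K := ⟨hx, hx'⟩
    rw [h0] at this
    exact this.elim
  · obtain ⟨y, hy, hmax⟩ := hKc.exists_isMaxOn h0 (cwTrial_continuous β h).continuousOn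
    refine ⟨cwTrial β h y, lt_of_not_ge fun hge => ?_, fun x hx hx' => hmax ⟨hx, hx'⟩⟩
    have hym : y = m := huniq y fun z hz => (hm hz : cwTrial β h z ≤ cwTrial β h m).trans hge
    have := hy.2
    simp only [Set.mem_ofPred_eq, hym, sub_self, abs_zero] at this
    linarith

/-- Within `δ` of `m` the integrand is at most `δ²`; elsewhere it is at most `4`, and that event has
exponentially small probability: fibre counting bounds the numerator, linearization at `p = m` the
partition function. -/
lemma gibbs_variance_le {N : ℕ} (hN : 0 < N) {β h m B δ : ℝ} (hβ : 0 ≤ β) (hm : |m| ≤ 1)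
    (hB : ∀ x, |x| ≤ 1 → δ ≤ |x - m| → cwTrial β h x ≤ B) :
    ∑ s : Fin N → Spin, gibbs β h s * (mag s - m) ^ 2 ≤
      δ ^ 2 + 4 * ((2 * N + 1) * Real.exp (B - cwTrial β h m) ^ N) := by
  classical
  set a : Fin 1 → Fin N → Spin := fun _ _ => 1 with ha
  have hov : ∀ s : Fin N → Spin, overlap a s 0 = mag s := fun s => by
    simp [overlap, mag, ha, val_one]
  set K : (Fin 1 → ℝ) → Prop := fun p => δ ≤ |p 0 - m| with hK
  have h1 : ∑ ξ with K (overlap a ξ), weight β h a ξ ≤ (2 * N + 1) * Real.exp (N * B) := by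
    have := sum_weight_filter_le hN β h a K B fun p hp hKp => by
      rw [ha, linearized_one hN]
      exact hB _ (hp 0) hKp
    simpa using this
  have h2 := exp_linearized_le_sum_weight hN hβ h a fun _ => m
  rw [ha, linearized_one hN, ← ha] at h2
  have h3 : ∑ ξ with K (overlap a ξ), gibbs β h ξ ≤
      (2 * N + 1) * Real.exp (B - cwTrial β h m) ^ N := by
    have e : ∑ ξ with K (overlap a ξ), gibbs β h ξ =
        (∑ ξ with K (overlap a ξ), weight β h a ξ) / ∑ t, weight β h a t := by
      rw [Finset.sum_div]
      exact Finset.sum_congr rfl fun s _ => gibbs_eq_weight hN β h s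
    rw [e, ← Real.exp_nat_mul, mul_sub, Real.exp_sub, ← mul_div_assoc]
    exact div_le_div₀ (by positivity) h1 (Real.exp_pos _) h2
  have h4 : ∀ s : Fin N → Spin, gibbs β h s * (mag s - m) ^ 2 ≤
      δ ^ 2 * gibbs β h s + 4 * if K (overlap a s) then gibbs β h s else 0 := fun s => by
    have hg := gibbs_nonneg β h s
    split_ifs with hs
    · have := abs_le.1 (abs_mag_le s)
      have hm' := abs_le.1 hm
      have : (mag s - m) ^ 2 ≤ 4 := by nlinarith
      nlinarith [sq_nonneg δ]
    · have hs' : |mag s - m| < δ := by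
        rw [← hov]
        exact not_le.1 hs
      have : (mag s - m) ^ 2 ≤ δ ^ 2 := by
        rw [← sq_abs]
        exact pow_le_pow_left₀ (abs_nonneg _) hs'.le 2
      nlinarith
  refine (Finset.sum_le_sum fun s _ => h4 s).trans ?_
  rw [Finset.sum_add_distrib, ← Finset.mul_sum, ← Finset.mul_sum, sum_gibbs, mul_one,
    ← Finset.sum_filter]
  linarith

lemma tendsto_gibbs_variance {β h m : ℝ} (hβ : 0 ≤ β) (hmem : |m| ≤ 1)
    (hm : IsMaxOn (cwTrial β h) Set.univ m)
    (huniq : ∀ y, IsMaxOn (cwTrial β h) Set.univ y → y = m) :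
    Tendsto (fun N : ℕ => ∑ s : Fin N → Spin, gibbs β h s * (mag s - m) ^ 2) atTop (𝓝 0) := by
  rw [tendsto_order]
  refine ⟨fun a ha => Eventually.of_forall fun N => lt_of_lt_of_le ha
    (Finset.sum_nonneg fun s _ => mul_nonneg (gibbs_nonneg β h s) (sq_nonneg _)), fun ε hε => ?_⟩
  obtain ⟨B, hBlt, hB⟩ := exists_lt_cwTrial hm huniq (δ := √(ε / 2)) (by positivity)
  set r := Real.exp (B - cwTrial β h m) with hr
  have hr1 : r < 1 := by
    rw [hr, Real.exp_lt_one_iff]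
    linarith
  have hr0 : 0 ≤ r := (Real.exp_pos _).le
  have hlim : Tendsto (fun N : ℕ => √(ε / 2) ^ 2 + 4 * ((2 * (N : ℝ) + 1) * r ^ N)) atTop
      (𝓝 (√(ε / 2) ^ 2 + 4 * (2 * 0 + 0))) := by
    have h1 := tendsto_self_mul_const_pow_of_lt_one hr0 hr1
    have h2 := tendsto_pow_atTop_nhds_zero_of_lt_one hr0 hr1
    have h3 := (((h1.const_mul 2).add h2).const_mul 4).const_add (√(ε / 2) ^ 2)
    refine h3.congr fun N => ?_
    ring
  have hlt : √(ε / 2) ^ 2 + 4 * (2 * 0 + 0) < ε := by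
    rw [Real.sq_sqrt (by positivity)]
    linarith
  filter_upwards [hlim.eventually_lt_const hlt, eventually_gt_atTop 0] with N hN hN0
  exact (gibbs_variance_le hN0 hβ hmem hB).trans_lt hN

lemma tendsto_meanMag {β h m : ℝ} (hβ : 0 ≤ β) (hmem : |m| ≤ 1)
    (hm : IsMaxOn (cwTrial β h) Set.univ m)
    (huniq : ∀ y, IsMaxOn (cwTrial β h) Set.univ y → y = m) :
    Tendsto (fun N : ℕ => meanMag N β h) atTop (𝓝 m) := by
  have hv := tendsto_gibbs_variance hβ hmem hm huniq
  have hs : Tendsto (fun N : ℕ => √(∑ s : Fin N → Spin, gibbs β h s * (mag s - m) ^ 2))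
      atTop (𝓝 0) := by simpa using hv.sqrt
  rw [tendsto_iff_norm_sub_tendsto_zero]
  refine squeeze_zero (fun _ => norm_nonneg _) (fun N => ?_) hs
  rw [Real.norm_eq_abs]
  refine Real.abs_le_sqrt ?_
  have := sq_sum_mul_le (f := fun s : Fin N → Spin => mag s - m) (gibbs_nonneg β h)
    (sum_gibbs N β h)
  have e : ∑ s : Fin N → Spin, gibbs β h s * (mag s - m) = meanMag N β h - m := by
    simp only [mul_sub, Finset.sum_sub_distrib, ← Finset.sum_mul, sum_gibbs, one_mul, meanMag]
  rwa [e] at this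

lemma tendsto_meanSqMag {β h m : ℝ} (hβ : 0 ≤ β) (hmem : |m| ≤ 1)
    (hm : IsMaxOn (cwTrial β h) Set.univ m)
    (huniq : ∀ y, IsMaxOn (cwTrial β h) Set.univ y → y = m) :
    Tendsto (fun N : ℕ => meanSqMag N β h) atTop (𝓝 (m ^ 2)) := by
  have hv := tendsto_gibbs_variance hβ hmem hm huniq
  have h1 := (hv.add ((tendsto_meanMag hβ hmem hm huniq).const_mul (2 * m))).sub_const (m ^ 2)
  rw [show 0 + 2 * m * m - m ^ 2 = m ^ 2 by ring] at h1
  refine h1.congr fun N => ?_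
  have e : ∑ s : Fin N → Spin, gibbs β h s * (mag s - m) ^ 2 =
      ∑ s : Fin N → Spin, (gibbs β h s * mag s ^ 2 - 2 * m * (gibbs β h s * mag s)
        + m ^ 2 * gibbs β h s) := Finset.sum_congr rfl fun s _ => by ring
  rw [e, Finset.sum_add_distrib, Finset.sum_sub_distrib, ← Finset.mul_sum, ← Finset.mul_sum,
    sum_gibbs, meanSqMag, meanMag]
  ring

/-! ### Exchangeability and two-point correlations -/

lemma cwExponent_comp_perm {N : ℕ} (β h : ℝ) (s : Fin N → Spin) (π : Equiv.Perm (Fin N)) :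
    cwExponent β h (s ∘ π) = cwExponent β h s := by
  unfold cwExponent
  rw [sum_Ioi_spin _ fun i => val_sq _, sum_Ioi_spin _ fun i => val_sq _]
  simp only [Function.comp_apply, Equiv.sum_comp π fun i => val (s i)]

lemma sum_gibbs_comp_perm {N : ℕ} (β h : ℝ) (π : Equiv.Perm (Fin N)) (f : (Fin N → Spin) → ℝ) :
    ∑ s, gibbs β h s * f (s ∘ π) = ∑ s, gibbs β h s * f s := by
  refine Fintype.sum_equiv (Equiv.arrowCongr π.symm (Equiv.refl Spin)) _ _ fun s => ?_
  have : (Equiv.arrowCongr π.symm (Equiv.refl Spin)) s = s ∘ π := by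
    funext i
    simp [Equiv.arrowCongr]
  rw [this, gibbs, gibbs, cwExponent_comp_perm]

lemma sum_gibbs_val {N : ℕ} (β h : ℝ) (i : Fin N) :
    ∑ s, gibbs β h s * val (s i) = meanMag N β h := by
  have hN : (N : ℝ) ≠ 0 := by
    have := i.pos
    positivity
  have key : ∀ j, ∑ s, gibbs β h s * val (s j) = ∑ s, gibbs β h s * val (s i) := fun j => by
    simpa using (sum_gibbs_comp_perm β h (Equiv.swap i j) fun s => val (s i))
  have e : meanMag N β h = (∑ j, ∑ s : Fin N → Spin, gibbs β h s * val (s j)) / N := by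
    rw [Finset.sum_comm, meanMag, Finset.sum_div]
    refine Finset.sum_congr rfl fun s _ => ?_
    rw [mag, ← Finset.mul_sum, mul_div_assoc]
  rw [e, Finset.sum_congr rfl fun j _ => key j]
  simp [hN]

/-- The two-point correlation of the Curie–Weiss model. -/
noncomputable def correlation (N : ℕ) (β h : ℝ) : ℝ :=
  (N * meanSqMag N β h - 1) / (N - 1)

/-- All off-diagonal correlations share one value `c`, so expanding the squared total spin gives `N²
meanSqMag = N + N (N - 1) c`. -/
lemma sum_gibbs_val_mul_val {N : ℕ} (β h : ℝ) {i j : Fin N} (hij : i ≠ j) :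
    ∑ s, gibbs β h s * (val (s i) * val (s j)) = correlation N β h := by
  have hN2 : 2 ≤ N := by
    have h1 := i.isLt
    have h2 := j.isLt
    have h3 : i.val ≠ j.val := fun h => hij (Fin.ext h)
    omega
  have hN : (N : ℝ) ≠ 0 := by positivity
  have hN1 : (N : ℝ) - 1 ≠ 0 := by
    have : (2 : ℝ) ≤ N := by exact_mod_cast hN2
    linarith
  set c := ∑ s, gibbs β h s * (val (s i) * val (s j)) with hc
  have key : ∀ k l : Fin N, k ≠ l → ∑ s, gibbs β h s * (val (s k) * val (s l)) = c := by
    intro k l hkl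
    obtain ⟨π, hπ⟩ : ∃ π : Equiv.Perm (Fin N), π i = k ∧ π j = l := by
      -- The first swap sends `i` to `k`; the second sends the image of `j` to `l` and fixes `k`,
      -- which is neither of them.
      refine ⟨(Equiv.swap i k).trans (Equiv.swap (Equiv.swap i k j) l), ?_, ?_⟩
      · have h1 : Equiv.swap i k j ≠ k := fun h => hij (by
          have := congrArg (Equiv.swap i k) h
          simpa using this.symm)
        simp [Equiv.swap_apply_of_ne_of_ne h1.symm hkl]
      · simp
    have := sum_gibbs_comp_perm β h π fun s => val (s i) * val (s j)
    simpa [hπ.1, hπ.2] using this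
  have hdiag : ∀ k : Fin N, ∑ s, gibbs β h s * (val (s k) * val (s k)) = 1 := fun k => by
    simp only [← sq, val_sq, mul_one, sum_gibbs]
  have e : (N : ℝ) ^ 2 * meanSqMag N β h =
      ∑ k : Fin N, ∑ l, ∑ s, gibbs β h s * (val (s k) * val (s l)) := by
    have : ∀ k : Fin N, ∑ l, ∑ s, gibbs β h s * (val (s k) * val (s l)) =
        ∑ s, gibbs β h s * (val (s k) * ∑ l, val (s l)) := fun k => by
      rw [Finset.sum_comm]
      simp only [Finset.mul_sum]
    simp only [this]
    rw [Finset.sum_comm, meanSqMag, Finset.mul_sum]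
    refine Finset.sum_congr rfl fun s _ => ?_
    rw [← Finset.mul_sum, ← Finset.sum_mul, mag]
    field_simp
  have e2 : ∀ k : Fin N, ∑ l, ∑ s, gibbs β h s * (val (s k) * val (s l)) = 1 + (N - 1) * c := by
    intro k
    rw [← Finset.add_sum_erase _ _ (Finset.mem_univ k), hdiag,
      Finset.sum_congr rfl fun l hl => key k l (Finset.ne_of_mem_erase hl).symm]
    simp [Finset.card_erase_of_mem, Nat.cast_sub (by omega : 1 ≤ N)]
  rw [Finset.sum_congr rfl fun k _ => e2 k] at e
  simp only [Finset.sum_const, Finset.card_univ, Fintype.card_fin, nsmul_eq_mul] at e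
  have e3 : (N : ℝ) * meanSqMag N β h = 1 + (N - 1) * c := by
    refine mul_left_cancel₀ hN ?_
    rw [← e]
    ring
  rw [correlation, e3]
  field_simp
  ring

lemma tendsto_correlation {β h m : ℝ} (hβ : 0 ≤ β) (hmem : |m| ≤ 1)
    (hm : IsMaxOn (cwTrial β h) Set.univ m)
    (huniq : ∀ y, IsMaxOn (cwTrial β h) Set.univ y → y = m) :
    Tendsto (fun N : ℕ => correlation N β h) atTop (𝓝 (m ^ 2)) := by
  have hq := tendsto_meanSqMag hβ hmem hm huniq
  have hinv : Tendsto (fun N : ℕ => (1 : ℝ) / N) atTop (𝓝 0) :=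
    tendsto_one_div_atTop_nhds_zero_nat
  have h1 : Tendsto (fun N : ℕ => (meanSqMag N β h - 1 / N) / (1 - 1 / (N : ℝ))) atTop
      (𝓝 ((m ^ 2 - 0) / (1 - 0))) :=
    (hq.sub hinv).div (hinv.const_sub 1) (by norm_num)
  rw [sub_zero, sub_zero, div_one] at h1
  refine h1.congr' ?_
  filter_upwards [eventually_gt_atTop 0] with N hN
  have hN' : (N : ℝ) ≠ 0 := by positivity
  rw [correlation, ← mul_div_mul_left (meanSqMag N β h - 1 / N) (1 - 1 / (N : ℝ)) hN']
  congr 1 <;> field_simp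

/-! ### Empirical law of the columns -/

/-- The law of `M` i.i.d. spins with mean `m`. -/
noncomputable def prodLaw {M : ℕ} (m : ℝ) (σ : Fin M → Spin) : ℝ :=
  ∏ μ, (1 + m * val (σ μ)) / 2

/-- The indicator that the spins of `S` at site `i` are `σ`. -/
noncomputable def siteIndicator {N M : ℕ} (S : Fin M → Fin N → Spin) (i : Fin N)
    (σ : Fin M → Spin) : ℝ :=
  ∏ μ, (1 + val (S μ i) * val (σ μ)) / 2

/-- The empirical distribution of the columns of `S`. -/
noncomputable def empirical {N M : ℕ} (S : Fin M → Fin N → Spin) (σ : Fin M → Spin) : ℝ :=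
  (∑ i, siteIndicator S i σ) / N

/-- The distribution of the training set with constant field. -/
noncomputable def gibbsProd {N M : ℕ} (β h : ℝ) (S : Fin M → Fin N → Spin) : ℝ :=
  ∏ μ, gibbs β h (S μ)

/-- The function `σ ↦ log cosh (β σ·p + lam)`. -/
noncomputable def siteEnergy {M : ℕ} (β lam : ℝ) (p : Fin M → ℝ) (σ : Fin M → Spin) : ℝ :=
  Real.log (Real.cosh (β * ∑ μ, val (σ μ) * p μ + lam))

/-- The product form of the indicator lets expectations factor over the independent patterns. -/
lemma siteIndicator_eq {N M : ℕ} (S : Fin M → Fin N → Spin) (i : Fin N) (σ : Fin M → Spin) :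
    siteIndicator S i σ = if (fun μ => S μ i) = σ then 1 else 0 := by
  have key : ∀ s t : Spin, (1 + val s * val t) / 2 = if s = t then 1 else 0 := by
    intro s t
    rcases Int.units_eq_one_or s with rfl | rfl <;> rcases Int.units_eq_one_or t with rfl | rfl <;>
      simp [val]
  unfold siteIndicator
  simp only [key, Finset.prod_ite_zero, Finset.prod_const_one, funext_iff, Finset.mem_univ,
    true_implies]

lemma siteIndicator_sq {N M : ℕ} (S : Fin M → Fin N → Spin) (i : Fin N) (σ : Fin M → Spin) :
    siteIndicator S i σ * siteIndicator S i σ = siteIndicator S i σ := by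
  rw [siteIndicator_eq]
  split_ifs <;> simp

lemma sum_siteIndicator_mul {N M : ℕ} (S : Fin M → Fin N → Spin) (i : Fin N)
    (F : (Fin M → Spin) → ℝ) :
    ∑ σ, siteIndicator S i σ * F σ = F fun μ => S μ i := by
  simp [siteIndicator_eq]

lemma sum_prodLaw (M : ℕ) (m : ℝ) : ∑ σ : Fin M → Spin, prodLaw m σ = 1 := by
  unfold prodLaw
  rw [sum_prod_pi fun _ (s : Spin) => (1 + m * val s) / 2]
  refine Finset.prod_eq_one fun μ _ => ?_
  rw [sum_spin, val_one, val_neg_one]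
  ring

lemma trial_eq {M : ℕ} (β lam m : ℝ) (p : Fin M → ℝ) :
    trial β lam m p = Real.log 2 - β / 2 * ∑ μ, p μ ^ 2 + ∑ σ, prodLaw m σ * siteEnergy β lam p σ := by
  unfold trial spinExpect prodLaw siteEnergy
  ring

lemma linearized_eq {N M : ℕ} (hN : 0 < N) (β lam : ℝ) (S : Fin M → Fin N → Spin)
    (p : Fin M → ℝ) :
    linearized β lam S p =
      Real.log 2 - β / 2 * ∑ μ, p μ ^ 2 + ∑ σ, empirical S σ * siteEnergy β lam p σ := by
  have hN' : (N : ℝ) ≠ 0 := by positivity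
  have h1 : ∑ σ, empirical S σ * siteEnergy β lam p σ =
      (∑ i, siteEnergy β lam p fun μ => S μ i) / N := by
    simp only [← sum_siteIndicator_mul S _ (siteEnergy β lam p), empirical]
    rw [Finset.sum_comm, Finset.sum_div]
    refine Finset.sum_congr rfl fun σ _ => ?_
    rw [← Finset.sum_mul]
    ring
  have h2 : ∀ i, Real.log (2 * Real.cosh (β * ∑ μ, val (S μ i) * p μ + lam)) =
      Real.log 2 + siteEnergy β lam p fun μ => S μ i := fun i => by
    rw [Real.log_mul two_ne_zero (Real.cosh_pos _).ne', siteEnergy]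
  rw [h1, linearized]
  simp only [h2, Finset.sum_add_distrib, Finset.sum_const, Finset.card_univ, Fintype.card_fin,
    nsmul_eq_mul]
  field_simp
  ring

lemma gibbsProd_nonneg {N M : ℕ} (β h : ℝ) (S : Fin M → Fin N → Spin) : 0 ≤ gibbsProd β h S :=
  Finset.prod_nonneg fun μ _ => gibbs_nonneg β h (S μ)

lemma sum_gibbsProd_mul_prod {N M : ℕ} (β h : ℝ) (f : Fin M → (Fin N → Spin) → ℝ) :
    ∑ S : Fin M → Fin N → Spin, gibbsProd β h S * ∏ μ, f μ (S μ) =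
      ∏ μ, ∑ s, gibbs β h s * f μ s := by
  rw [← sum_prod_pi fun μ (s : Fin N → Spin) => gibbs β h s * f μ s]
  simp only [gibbsProd, Finset.prod_mul_distrib]

lemma sum_gibbsProd (N M : ℕ) (β h : ℝ) :
    ∑ S : Fin M → Fin N → Spin, gibbsProd β h S = 1 := by
  have := sum_gibbsProd_mul_prod (N := N) (M := M) β h fun _ _ => 1
  simpa [sum_gibbs] using this

lemma sum_gibbsProd_siteIndicator {N M : ℕ} (β h : ℝ) (i : Fin N) (σ : Fin M → Spin) :
    ∑ S : Fin M → Fin N → Spin, gibbsProd β h S * siteIndicator S i σ =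
      prodLaw (meanMag N β h) σ := by
  unfold siteIndicator prodLaw
  rw [sum_gibbsProd_mul_prod β h fun μ s => (1 + val (s i) * val (σ μ)) / 2]
  refine Finset.prod_congr rfl fun μ _ => ?_
  have e : ∀ s : Fin N → Spin, gibbs β h s * ((1 + val (s i) * val (σ μ)) / 2) =
      (gibbs β h s + gibbs β h s * val (s i) * val (σ μ)) / 2 := fun s => by ring
  simp only [e, ← Finset.sum_div, Finset.sum_add_distrib, ← Finset.sum_mul, sum_gibbs,
    sum_gibbs_val]

/-- The probability that the spins at two different sites are both given by `σ`. -/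
noncomputable def pairLaw {M : ℕ} (m c : ℝ) (σ : Fin M → Spin) : ℝ :=
  ∏ μ, (1 + 2 * m * val (σ μ) + c) / 4

lemma sum_gibbsProd_siteIndicator_mul {N M : ℕ} (β h : ℝ) {i j : Fin N} (hij : i ≠ j)
    (σ : Fin M → Spin) :
    ∑ S : Fin M → Fin N → Spin, gibbsProd β h S * (siteIndicator S i σ * siteIndicator S j σ) =
      pairLaw (meanMag N β h) (correlation N β h) σ := by
  unfold siteIndicator pairLaw
  simp only [← Finset.prod_mul_distrib]
  rw [sum_gibbsProd_mul_prod β h fun μ s =>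
    (1 + val (s i) * val (σ μ)) / 2 * ((1 + val (s j) * val (σ μ)) / 2)]
  refine Finset.prod_congr rfl fun μ _ => ?_
  have e : ∀ s : Fin N → Spin, gibbs β h s *
      ((1 + val (s i) * val (σ μ)) / 2 * ((1 + val (s j) * val (σ μ)) / 2)) =
      (gibbs β h s + gibbs β h s * val (s i) * val (σ μ) + gibbs β h s * val (s j) * val (σ μ)
        + gibbs β h s * (val (s i) * val (s j))) / 4 := fun s => by
    have := val_sq (σ μ)
    linear_combination (gibbs β h s * (val (s i) * val (s j))) / 4 * this
  simp only [e, ← Finset.sum_div, Finset.sum_add_distrib, ← Finset.sum_mul, sum_gibbs,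
    sum_gibbs_val, sum_gibbs_val_mul_val β h hij]
  ring

lemma sum_gibbsProd_empirical {N M : ℕ} (hN : 0 < N) (β h : ℝ) (σ : Fin M → Spin) :
    ∑ S : Fin M → Fin N → Spin, gibbsProd β h S * empirical S σ = prodLaw (meanMag N β h) σ := by
  have hN' : (N : ℝ) ≠ 0 := by positivity
  simp only [empirical, ← mul_div_assoc, ← Finset.sum_div, Finset.mul_sum]
  rw [Finset.sum_comm, Finset.sum_congr rfl fun i _ => sum_gibbsProd_siteIndicator β h i σ]
  simp [hN']

lemma sum_gibbsProd_empirical_sq {N M : ℕ} (hN : 0 < N) (β h : ℝ) (σ : Fin M → Spin) :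
    ∑ S : Fin M → Fin N → Spin, gibbsProd β h S * empirical S σ ^ 2 =
      1 / N * prodLaw (meanMag N β h) σ +
        (1 - 1 / N) * pairLaw (meanMag N β h) (correlation N β h) σ := by
  have hN' : (N : ℝ) ≠ 0 := by positivity
  have e : ∀ S : Fin M → Fin N → Spin, gibbsProd β h S * empirical S σ ^ 2 =
      (∑ i, ∑ j, gibbsProd β h S * (siteIndicator S i σ * siteIndicator S j σ)) / N ^ 2 := fun S => by
    rw [empirical, div_pow, sq (∑ i, _), Finset.sum_mul_sum, ← mul_div_assoc]
    simp only [Finset.mul_sum]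
  simp only [e, ← Finset.sum_div]
  rw [Finset.sum_comm]
  have e2 : ∀ i : Fin N, ∑ S : Fin M → Fin N → Spin, ∑ j,
      gibbsProd β h S * (siteIndicator S i σ * siteIndicator S j σ) =
      prodLaw (meanMag N β h) σ +
        (N - 1) * pairLaw (meanMag N β h) (correlation N β h) σ := fun i => by
    rw [Finset.sum_comm, ← Finset.add_sum_erase _ _ (Finset.mem_univ i),
      Finset.sum_congr rfl fun j hj =>
        sum_gibbsProd_siteIndicator_mul β h (Finset.ne_of_mem_erase hj).symm σ]
    simp only [siteIndicator_sq, sum_gibbsProd_siteIndicator]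
    simp [Finset.card_erase_of_mem, Nat.cast_sub (by omega : 1 ≤ N)]
  rw [Finset.sum_congr rfl fun i _ => e2 i]
  simp only [Finset.sum_const, Finset.card_univ, Fintype.card_fin, nsmul_eq_mul]
  field_simp

lemma sum_gibbsProd_empirical_variance {N M : ℕ} (hN : 0 < N) (β h m : ℝ) (σ : Fin M → Spin) :
    ∑ S : Fin M → Fin N → Spin, gibbsProd β h S * (empirical S σ - prodLaw m σ) ^ 2 =
      1 / N * prodLaw (meanMag N β h) σ +
        (1 - 1 / N) * pairLaw (meanMag N β h) (correlation N β h) σ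
        - 2 * prodLaw m σ * prodLaw (meanMag N β h) σ + prodLaw m σ ^ 2 := by
  have e : ∀ S : Fin M → Fin N → Spin, gibbsProd β h S * (empirical S σ - prodLaw m σ) ^ 2 =
      gibbsProd β h S * empirical S σ ^ 2 - 2 * prodLaw m σ * (gibbsProd β h S * empirical S σ)
        + prodLaw m σ ^ 2 * gibbsProd β h S := fun S => by ring
  simp only [e, Finset.sum_add_distrib, Finset.sum_sub_distrib, ← Finset.mul_sum,
    sum_gibbsProd_empirical_sq hN, sum_gibbsProd_empirical hN, sum_gibbsProd, mul_one]

/-- Asymptotic independence of two sites: this cancellation makes the limiting variance of the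
empirical law vanish. -/
lemma pairLaw_sq {M : ℕ} (m : ℝ) (σ : Fin M → Spin) : pairLaw m (m ^ 2) σ = prodLaw m σ ^ 2 := by
  unfold pairLaw prodLaw
  rw [← Finset.prod_pow]
  refine Finset.prod_congr rfl fun μ _ => ?_
  linear_combination -(m ^ 2 / 4) * val_sq (σ μ)

lemma continuous_prodLaw {M : ℕ} (σ : Fin M → Spin) : Continuous fun m => prodLaw m σ := by
  unfold prodLaw
  fun_prop

lemma continuous_trial {M : ℕ} (β lam : ℝ) (p : Fin M → ℝ) :
    Continuous fun m => trial β lam m p := by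
  simp only [trial_eq]
  exact continuous_const.add
    (continuous_finsetSum _ fun σ _ => (continuous_prodLaw σ).mul continuous_const)

/-- The mean total variation distance (up to a factor `2`) between the empirical column
distribution and the law of i.i.d. spins with mean `m`. -/
noncomputable def meanDistance (N M : ℕ) (β h m : ℝ) : ℝ :=
  ∑ S : Fin M → Fin N → Spin, gibbsProd β h S * ∑ σ, |empirical S σ - prodLaw m σ|

lemma tendsto_meanDistance (M : ℕ) {β h m : ℝ} (hβ : 0 ≤ β) (hmem : |m| ≤ 1)
    (hm : IsMaxOn (cwTrial β h) Set.univ m)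
    (huniq : ∀ y, IsMaxOn (cwTrial β h) Set.univ y → y = m) :
    Tendsto (fun N : ℕ => meanDistance N M β h m) atTop (𝓝 0) := by
  have hmag := tendsto_meanMag hβ hmem hm huniq
  have hcor := tendsto_correlation hβ hmem hm huniq
  have hinv : Tendsto (fun N : ℕ => (1 : ℝ) / N) atTop (𝓝 0) :=
    tendsto_one_div_atTop_nhds_zero_nat
  have hvar : ∀ σ : Fin M → Spin, Tendsto (fun N : ℕ => ∑ S : Fin M → Fin N → Spin,
      gibbsProd β h S * (empirical S σ - prodLaw m σ) ^ 2) atTop (𝓝 0) := fun σ => by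
    have hp : Tendsto (fun N : ℕ => prodLaw (meanMag N β h) σ) atTop (𝓝 (prodLaw m σ)) :=
      ((continuous_prodLaw σ).tendsto m).comp hmag
    have hq : Tendsto (fun N : ℕ => pairLaw (meanMag N β h) (correlation N β h) σ) atTop
        (𝓝 (pairLaw m (m ^ 2) σ)) := by
      unfold pairLaw
      exact tendsto_finsetProd _ fun μ _ =>
        ((((hmag.const_mul 2).mul_const (val (σ μ))).const_add 1).add hcor).div_const 4
    have h1 := (((hinv.mul hp).add ((hinv.const_sub 1).mul hq)).sub
      (hp.const_mul (2 * prodLaw m σ))).add_const (prodLaw m σ ^ 2)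
    rw [pairLaw_sq, show 0 * prodLaw m σ + (1 - 0) * prodLaw m σ ^ 2
      - 2 * prodLaw m σ * prodLaw m σ + prodLaw m σ ^ 2 = 0 by ring] at h1
    refine h1.congr' ?_
    filter_upwards [eventually_gt_atTop 0] with N hN
    exact (sum_gibbsProd_empirical_variance hN β h m σ).symm
  have habs : ∀ σ : Fin M → Spin, Tendsto (fun N : ℕ => ∑ S : Fin M → Fin N → Spin,
      gibbsProd β h S * |empirical S σ - prodLaw m σ|) atTop (𝓝 0) := fun σ => by
    have hs : Tendsto (fun N : ℕ => √(∑ S : Fin M → Fin N → Spin,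
        gibbsProd β h S * (empirical S σ - prodLaw m σ) ^ 2)) atTop (𝓝 0) := by
      simpa using (hvar σ).sqrt
    refine squeeze_zero (fun N => Finset.sum_nonneg fun S _ =>
      mul_nonneg (gibbsProd_nonneg β h S) (abs_nonneg _)) (fun N => ?_) hs
    refine Real.le_sqrt_of_sq_le ?_
    simpa using sq_sum_mul_le (f := fun S : Fin M → Fin N → Spin => |empirical S σ - prodLaw m σ|)
      (gibbsProd_nonneg β h) (sum_gibbsProd N M β h)
  have hsum := tendsto_finsetSum Finset.univ fun σ (_ : σ ∈ Finset.univ) => habs σ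
  rw [Finset.sum_const_zero] at hsum
  refine hsum.congr fun N => ?_
  rw [meanDistance, Finset.sum_comm]
  simp only [Finset.mul_sum]

/-! ### Gauge symmetry in the signs of the fields -/

lemma cwProb_const {N M : ℕ} (β h : ℝ) (S : Fin M → Fin N → Spin) :
    cwProb β (fun _ => h) S = gibbsProd β h S := rfl

lemma cwExponent_mul_spin {N : ℕ} (β h : ℝ) (e : Spin) (s : Fin N → Spin) :
    cwExponent β (h * val e) (fun i => e * s i) = cwExponent β h s := by
  unfold cwExponent
  rw [sum_Ioi_spin _ fun i => val_sq _, sum_Ioi_spin _ fun i => val_sq _]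
  simp only [val_mul, ← Finset.mul_sum]
  have := val_sq e
  linear_combination (β / N * (∑ i, val (s i)) ^ 2 / 2 + h * ∑ i, val (s i)) * this

lemma cwPartition_mul_spin (N : ℕ) (β h : ℝ) (e : Spin) :
    cwPartition N β (h * val e) = cwPartition N β h := by
  unfold cwPartition
  refine (Fintype.sum_equiv (Equiv.mulLeft fun _ : Fin N => e) _ _ fun s => ?_).symm
  exact congrArg Real.exp (cwExponent_mul_spin β h e s).symm

/-- Flipping patterns shows that the signs of the fields are irrelevant. -/
lemma quenchedPressure_mul_spin (N M : ℕ) (β lam h : ℝ) (ε : Fin M → Spin) :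
    quenchedPressure N M β lam (fun μ => h * val (ε μ)) =
      quenchedPressure N M β lam fun _ => h := by
  unfold quenchedPressure
  congr 1
  refine (Fintype.sum_equiv (Equiv.mulLeft fun μ (_ : Fin N) => ε μ) _ _ fun S => ?_).symm
  have h1 : cwProb β (fun μ => h * val (ε μ)) ((fun μ (_ : Fin N) => ε μ) * S) =
      cwProb β (fun _ => h) S := by
    unfold cwProb
    refine Finset.prod_congr rfl fun μ _ => ?_
    rw [cwPartition_mul_spin]
    congr 2
    exact cwExponent_mul_spin β h (ε μ) (S μ)
  have h2 : hopfieldPartition β lam ((fun μ (_ : Fin N) => ε μ) * S) =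
      hopfieldPartition β lam S := by
    unfold hopfieldPartition
    simp only [Pi.mul_apply, val_mul]
    refine Finset.sum_congr rfl fun ξ _ => ?_
    congr 3
    refine Finset.sum_congr rfl fun μ _ => Finset.sum_congr rfl fun i _ =>
      Finset.sum_congr rfl fun j _ => ?_
    linear_combination (val (S μ i) * val (S μ j) * val (ξ i) * val (ξ j)) * val_sq (ε μ)
  simp only [Equiv.coe_mulLeft]
  rw [h1, h2]

/-! ### Bounds on the quenched pressure -/

lemma trial_le {M : ℕ} {β lam m : ℝ} (hβ : 0 ≤ β) (hm : |m| ≤ 1) (p : Fin M → ℝ) :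
    trial β lam m p ≤ Real.log 2 + β * M / 2 + |lam| := by
  have hw : ∀ σ : Fin M → Spin, 0 ≤ prodLaw m σ := fun σ => by
    refine Finset.prod_nonneg fun μ _ => ?_
    have : |m * val (σ μ)| ≤ 1 := by rwa [abs_mul, abs_val, mul_one]
    linarith [(abs_le.1 this).1]
  have hF : ∀ σ, siteEnergy β lam p σ ≤ β * ∑ μ, |p μ| + |lam| := fun σ => by
    refine (log_cosh_le_abs _).trans ((abs_add_le _ _).trans ?_)
    rw [abs_mul, abs_of_nonneg hβ]
    gcongr
    refine (Finset.abs_sum_le_sum_abs _ _).trans (le_of_eq ?_)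
    simp [abs_mul, abs_val]
  have h1 : ∑ σ, prodLaw m σ * siteEnergy β lam p σ ≤ β * ∑ μ, |p μ| + |lam| := by
    refine (Finset.sum_le_sum fun σ _ => mul_le_mul_of_nonneg_left (hF σ) (hw σ)).trans ?_
    rw [← Finset.sum_mul, sum_prodLaw, one_mul]
  have h2 : ∑ μ, |p μ| ≤ (∑ μ, p μ ^ 2 + M) / 2 := by
    have : (M : ℝ) = ∑ _μ : Fin M, (1 : ℝ) := by simp
    rw [this, ← Finset.sum_add_distrib, Finset.sum_div]
    exact Finset.sum_le_sum fun μ _ => by nlinarith [sq_nonneg (|p μ| - 1), sq_abs (p μ)]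
  rw [trial_eq]
  nlinarith [mul_le_mul_of_nonneg_left h2 hβ]

lemma abs_siteEnergy_le {M : ℕ} {β lam : ℝ} (hβ : 0 ≤ β) {p : Fin M → ℝ} (hp : ∀ μ, |p μ| ≤ 1)
    (σ : Fin M → Spin) : |siteEnergy β lam p σ| ≤ β * M + |lam| := by
  rw [siteEnergy, abs_of_nonneg (log_cosh_nonneg _)]
  refine (log_cosh_le_abs _).trans ((abs_add_le _ _).trans ?_)
  rw [abs_mul, abs_of_nonneg hβ]
  gcongr
  refine (Finset.abs_sum_le_sum_abs _ _).trans ?_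
  calc ∑ μ, |val (σ μ) * p μ| ≤ ∑ _μ : Fin M, (1 : ℝ) :=
        Finset.sum_le_sum fun μ _ => by rw [abs_mul, abs_val, one_mul]; exact hp μ
    _ = M := by simp

/-- The error does not depend on `p`, so it survives maximization over the cube, where all overlaps
lie. -/
lemma linearized_le {N M : ℕ} (hN : 0 < N) {β lam m : ℝ} (hβ : 0 ≤ β)
    (S : Fin M → Fin N → Spin) {p : Fin M → ℝ} (hp : ∀ μ, |p μ| ≤ 1) :
    linearized β lam S p ≤
      trial β lam m p + (β * M + |lam|) * ∑ σ, |empirical S σ - prodLaw m σ| := by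
  have h : ∑ σ, empirical S σ * siteEnergy β lam p σ ≤ ∑ σ, prodLaw m σ * siteEnergy β lam p σ
      + (β * M + |lam|) * ∑ σ, |empirical S σ - prodLaw m σ| := by
    rw [Finset.mul_sum, ← Finset.sum_add_distrib]
    refine Finset.sum_le_sum fun σ _ => ?_
    have h1 := abs_siteEnergy_le (lam := lam) hβ hp σ
    have h2 : (empirical S σ - prodLaw m σ) * siteEnergy β lam p σ ≤
        (β * M + |lam|) * |empirical S σ - prodLaw m σ| := by
      refine (le_abs_self _).trans ?_
      rw [abs_mul, mul_comm]
      gcongr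
    linarith
  rw [linearized_eq hN, trial_eq]
  linarith

lemma log_hopfieldPartition {N M : ℕ} (hN : 0 < N) (β lam : ℝ) (S : Fin M → Fin N → Spin) :
    Real.log (hopfieldPartition β lam S) = -(β * M / 2) + Real.log (∑ ξ, weight β lam S ξ) := by
  have hpos : 0 < ∑ ξ, weight β lam S ξ :=
    Finset.sum_pos (fun _ _ => Real.exp_pos _) Finset.univ_nonempty
  rw [hopfieldPartition_eq hN, Real.log_mul (Real.exp_pos _).ne' hpos.ne', Real.log_exp]

lemma le_log_hopfieldPartition {N M : ℕ} (hN : 0 < N) {β : ℝ} (hβ : 0 ≤ β) (lam : ℝ)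
    (S : Fin M → Fin N → Spin) (p : Fin M → ℝ) :
    -(β * M / 2) + N * linearized β lam S p ≤ Real.log (hopfieldPartition β lam S) := by
  rw [log_hopfieldPartition hN]
  gcongr
  rw [← Real.log_exp (N * linearized β lam S p)]
  exact Real.log_le_log (Real.exp_pos _) (exp_linearized_le_sum_weight hN hβ lam S p)

lemma log_hopfieldPartition_le {N M : ℕ} (hN : 0 < N) {β : ℝ} (hβ : 0 ≤ β) (lam : ℝ)
    (S : Fin M → Fin N → Spin) (B : ℝ)
    (hB : ∀ p : Fin M → ℝ, (∀ μ, |p μ| ≤ 1) → linearized β lam S p ≤ B) :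
    Real.log (hopfieldPartition β lam S) ≤ M * Real.log (2 * N + 1) + N * B := by
  have hpos : 0 < ∑ ξ, weight β lam S ξ :=
    Finset.sum_pos (fun _ _ => Real.exp_pos _) Finset.univ_nonempty
  have h1 := Real.log_le_log hpos (sum_weight_le hN β lam S B hB)
  rw [Real.log_mul (by positivity) (Real.exp_pos _).ne', Real.log_exp, Real.log_pow] at h1
  rw [log_hopfieldPartition hN]
  have : 0 ≤ β * M / 2 := by positivity
  linarith

/-- `linearized` is affine in the empirical law, whose mean is exactly `prodLaw` at the finite-size
magnetization. -/
lemma sum_gibbsProd_linearized {N M : ℕ} (hN : 0 < N) (β lam h : ℝ) (p : Fin M → ℝ) :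
    ∑ S : Fin M → Fin N → Spin, gibbsProd β h S * linearized β lam S p =
      trial β lam (meanMag N β h) p := by
  have h1 : ∑ S : Fin M → Fin N → Spin, gibbsProd β h S *
      ∑ σ, empirical S σ * siteEnergy β lam p σ =
      ∑ σ, prodLaw (meanMag N β h) σ * siteEnergy β lam p σ := by
    simp only [Finset.mul_sum]
    rw [Finset.sum_comm]
    simp only [← mul_assoc, ← Finset.sum_mul, sum_gibbsProd_empirical hN]
  simp only [linearized_eq hN, mul_add, Finset.sum_add_distrib, ← Finset.sum_mul, sum_gibbsProd,
    one_mul]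
  rw [h1, trial_eq]

lemma trial_le_quenchedPressure {N M : ℕ} (hN : 0 < N) {β : ℝ} (hβ : 0 ≤ β) (lam h : ℝ)
    (p : Fin M → ℝ) :
    trial β lam (meanMag N β h) p - β * M / 2 * (1 / N) ≤
      quenchedPressure N M β lam fun _ => h := by
  have hN' : (0 : ℝ) < N := by exact_mod_cast hN
  have h1 : ∑ S : Fin M → Fin N → Spin,
      gibbsProd β h S * (-(β * M / 2) + N * linearized β lam S p) ≤
      ∑ S : Fin M → Fin N → Spin, gibbsProd β h S * Real.log (hopfieldPartition β lam S) :=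
    Finset.sum_le_sum fun S _ => mul_le_mul_of_nonneg_left
      (le_log_hopfieldPartition hN hβ lam S p) (gibbsProd_nonneg β h S)
  have h2 : ∑ S : Fin M → Fin N → Spin,
      gibbsProd β h S * (-(β * M / 2) + N * linearized β lam S p) =
      -(β * M / 2) + N * trial β lam (meanMag N β h) p := by
    have e : ∀ S : Fin M → Fin N → Spin,
        gibbsProd β h S * (-(β * M / 2) + N * linearized β lam S p) =
        gibbsProd β h S * -(β * M / 2) + N * (gibbsProd β h S * linearized β lam S p) :=
      fun S => by ring
    simp only [e, Finset.sum_add_distrib, ← Finset.sum_mul, ← Finset.mul_sum, sum_gibbsProd,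
      sum_gibbsProd_linearized hN, one_mul]
  rw [h2] at h1
  unfold quenchedPressure
  simp only [cwProb_const]
  refine le_trans (le_of_eq ?_) (mul_le_mul_of_nonneg_left h1 (by positivity : 0 ≤ 1 / (N : ℝ)))
  field_simp
  ring

lemma quenchedPressure_le {N M : ℕ} (hN : 0 < N) {β lam m L : ℝ} (hβ : 0 ≤ β) (h : ℝ)
    (hL : ∀ p : Fin M → ℝ, trial β lam m p ≤ L) :
    quenchedPressure N M β lam (fun _ => h) ≤
      M * (Real.log (2 * N + 1) / N) + (L + (β * M + |lam|) * meanDistance N M β h m) := by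
  have hN' : (0 : ℝ) < N := by exact_mod_cast hN
  set C := β * M + |lam| with hC
  have h1 : ∑ S : Fin M → Fin N → Spin, gibbsProd β h S * Real.log (hopfieldPartition β lam S) ≤
      ∑ S : Fin M → Fin N → Spin, gibbsProd β h S *
        (M * Real.log (2 * N + 1) + N * (L + C * ∑ σ, |empirical S σ - prodLaw m σ|)) :=
    Finset.sum_le_sum fun S _ => mul_le_mul_of_nonneg_left
      (log_hopfieldPartition_le hN hβ lam S _ fun p hp =>
        (linearized_le hN hβ S hp).trans (by linarith [hL p])) (gibbsProd_nonneg β h S)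
  have h2 : ∑ S : Fin M → Fin N → Spin, gibbsProd β h S *
      (M * Real.log (2 * N + 1) + N * (L + C * ∑ σ, |empirical S σ - prodLaw m σ|)) =
      M * Real.log (2 * N + 1) + N * (L + C * meanDistance N M β h m) := by
    have e : ∀ S : Fin M → Fin N → Spin, gibbsProd β h S *
        (M * Real.log (2 * N + 1) + N * (L + C * ∑ σ, |empirical S σ - prodLaw m σ|)) =
        gibbsProd β h S * (M * Real.log (2 * N + 1) + N * L) +
          N * C * (gibbsProd β h S * ∑ σ, |empirical S σ - prodLaw m σ|) := fun S => by ring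
    rw [Finset.sum_congr rfl fun S _ => e S, Finset.sum_add_distrib, ← Finset.sum_mul,
      ← Finset.mul_sum, sum_gibbsProd, meanDistance]
    ring
  rw [h2] at h1
  unfold quenchedPressure
  simp only [cwProb_const]
  refine (mul_le_mul_of_nonneg_left h1 (by positivity : 0 ≤ 1 / (N : ℝ))).trans (le_of_eq ?_)
  field_simp

/-! ### Passage to the limit and the case `β = 0` -/

lemma tendsto_log_div : Tendsto (fun N : ℕ => Real.log (2 * N + 1) / N) atTop (𝓝 0) := by
  have h1 : Tendsto (fun N : ℕ => (2 * (N : ℝ) + 1)) atTop atTop :=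
    tendsto_atTop_add_const_right _ _
      (tendsto_natCast_atTop_atTop.const_mul_atTop (by norm_num : (0 : ℝ) < 2))
  have h2 : Tendsto (fun N : ℕ => Real.log (2 * N + 1) / (2 * N + 1)) atTop (𝓝 0) :=
    (Real.isLittleO_log_id_atTop.tendsto_div_nhds_zero).comp h1
  have h3 : Tendsto (fun N : ℕ => 2 + (1 : ℝ) / N) atTop (𝓝 (2 + 0)) :=
    (tendsto_one_div_atTop_nhds_zero_nat).const_add 2
  have h4 := h2.mul h3
  rw [zero_mul] at h4
  refine h4.congr' ?_
  filter_upwards [eventually_gt_atTop 0] with N hN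
  have hN' : (0 : ℝ) < N := by exact_mod_cast hN
  field_simp

lemma tendsto_quenchedPressure {M : ℕ} {β lam h m L : ℝ} (hβ : 0 ≤ β) (hmem : |m| ≤ 1)
    (hm : IsMaxOn (cwTrial β h) Set.univ m)
    (huniq : ∀ y, IsMaxOn (cwTrial β h) Set.univ y → y = m)
    (hL : IsLUB (Set.range fun p : Fin M → ℝ => trial β lam m p) L) :
    Tendsto (fun N : ℕ => quenchedPressure N M β lam fun _ => h) atTop (𝓝 L) := by
  rw [tendsto_order]
  constructor
  · intro a ha
    -- A near-optimal `p` is fixed before `N` grows, so only pointwise convergence is needed here.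
    obtain ⟨-, ⟨p, rfl⟩, hp, -⟩ := hL.exists_between ha
    have h1 : Tendsto (fun N : ℕ => trial β lam (meanMag N β h) p - β * M / 2 * (1 / N)) atTop
        (𝓝 (trial β lam m p - β * M / 2 * 0)) :=
      (((continuous_trial β lam p).tendsto m).comp (tendsto_meanMag hβ hmem hm huniq)).sub
        ((tendsto_one_div_atTop_nhds_zero_nat).const_mul _)
    rw [mul_zero, sub_zero] at h1
    filter_upwards [h1.eventually_const_lt hp, eventually_gt_atTop 0] with N hN hN0
    exact hN.trans_le (trial_le_quenchedPressure hN0 hβ lam h p)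
  · intro a ha
    have h1 : Tendsto (fun N : ℕ => M * (Real.log (2 * N + 1) / N) +
        (L + (β * M + |lam|) * meanDistance N M β h m)) atTop
        (𝓝 (M * 0 + (L + (β * M + |lam|) * 0))) :=
      (tendsto_log_div.const_mul _).add
        (((tendsto_meanDistance M hβ hmem hm huniq).const_mul _).const_add L)
    rw [mul_zero, mul_zero, zero_add, add_zero] at h1
    filter_upwards [h1.eventually_lt_const ha, eventually_gt_atTop 0] with N hN hN0
    exact (quenchedPressure_le hN0 hβ h fun p => hL.1 ⟨p, rfl⟩).trans_lt hN

lemma trial_zero_left {M : ℕ} (lam m : ℝ) (p : Fin M → ℝ) :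
    trial 0 lam m p = Real.log 2 + Real.log (Real.cosh lam) := by
  rw [trial_eq]
  simp [siteEnergy, ← Finset.sum_mul, sum_prodLaw]

/-- At `β = 0` the Curie–Weiss trial function is constant, so the argument by a unique maximizer is
unavailable; but `Z` no longer depends on the training set. -/
lemma quenchedPressure_zero {N : ℕ} (hN : 0 < N) (M : ℕ) (lam h : ℝ) :
    quenchedPressure N M 0 lam (fun _ => h) = Real.log 2 + Real.log (Real.cosh lam) := by
  have hN' : (N : ℝ) ≠ 0 := by positivity
  have hZ : ∀ S : Fin M → Fin N → Spin, Real.log (hopfieldPartition 0 lam S) =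
      N * (Real.log 2 + Real.log (Real.cosh lam)) := fun S => by
    have := sum_exp_linear fun _ : Fin N => lam
    simp only [Finset.prod_const, Finset.card_univ, Fintype.card_fin] at this
    simp only [← Finset.mul_sum] at this
    simp only [hopfieldPartition, zero_div, zero_mul, zero_add]
    rw [this, Real.log_pow, Real.log_mul two_ne_zero (Real.cosh_pos _).ne']
  unfold quenchedPressure
  simp only [cwProb_const, hZ, ← Finset.sum_mul, sum_gibbsProd]
  field_simp

lemma exists_isLUB_trial (M : ℕ) {β : ℝ} (lam : ℝ) {m : ℝ} (hβ : 0 ≤ β) (hm : |m| ≤ 1) :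
    ∃ L, IsLUB (Set.range fun p : Fin M → ℝ => trial β lam m p) L :=
  Real.exists_isLUB (Set.range_nonempty _)
    ⟨_, Set.forall_mem_range.2 fun p => trial_le hβ hm p⟩

end DualHopfield

theorem theorem1 (M : ℕ) (β lam h : ℝ) (hβ : 0 ≤ β)
    (hreg : β ≤ 1 ∨ (1 < β ∧ lam ≠ 0 ∧ h ≠ 0)) :
    -- `m₀(β, h)` is well defined for `β > 0`, and is the mean of some `±1` random variable
    (0 < β → ∃ m₀ ∈ Set.Ioo (-1 : ℝ) 1, IsMaxOn (DualHopfield.cwTrial β h) Set.univ m₀ ∧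
      ∀ y : ℝ, IsMaxOn (DualHopfield.cwTrial β h) Set.univ y → y = m₀) ∧
    -- the limit of the quenched free energy, the same for all sign vectors `ε`
    (∀ m₀ ∈ Set.Icc (-1 : ℝ) 1, IsMaxOn (DualHopfield.cwTrial β h) Set.univ m₀ →
      ∃ L : ℝ, IsLUB (Set.range fun p : Fin M → ℝ => DualHopfield.trial β lam m₀ p) L ∧
        ∀ ε : Fin M → DualHopfield.Spin,
          Tendsto (fun N : ℕ => DualHopfield.quenchedPressure N M β lam
            (fun μ => h * DualHopfield.val (ε μ))) atTop (𝓝 L)) := by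
  have hreg' : β ≤ 1 ∨ h ≠ 0 := hreg.imp_right fun H => H.2.2
  refine ⟨fun hpos => DualHopfield.exists_unique_isMaxOn_cwTrial hpos hreg', fun m hm hmax => ?_⟩
  have hm' : |m| ≤ 1 := abs_le.2 hm
  obtain ⟨L, hL⟩ := DualHopfield.exists_isLUB_trial M lam hβ hm'
  refine ⟨L, hL, fun ε => ?_⟩
  simp only [DualHopfield.quenchedPressure_mul_spin]
  rcases hβ.eq_or_lt with rfl | hpos
  · have hL' : L = Real.log 2 + Real.log (Real.cosh lam) := by
      simp only [DualHopfield.trial_zero_left, Set.range_const] at hL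
      exact hL.unique isLUB_singleton
    refine tendsto_const_nhds.congr' ?_
    -- `N = 0` is excluded because there `1 / N = 0` makes the pressure zero.
    filter_upwards [eventually_gt_atTop 0] with N hN
    rw [DualHopfield.quenchedPressure_zero hN, hL']
  · exact DualHopfield.tendsto_quenchedPressure hβ hm' hmax
      (fun y hy => DualHopfield.isMaxOn_cwTrial_unique hpos hreg' hy hmax) hL
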